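/- Rings are associative with $1\neq 0$ and subrings contain the identity of the ambient ring. For a ring $R$ let $\mathcal C_R$ be the set of regular elements of $R$ (elements that are neither left nor right zero divisors). A left ideal of $R$ is essential if it has nonzero intersection with every nonzero left ideal of $R$. Let $\mathrm{udim}(R)$ be the left uniform dimension of $R$, i.e. the supremum of all $n$ such that $R$ contains a direct sum of $n$ nonzero left ideals; $R$ is left Goldie if $\mathrm{udim}(R)<\infty$ and $R$ satisfies the ascending chain condition on left annihilators of subsets. A multiplicative subset $S\subseteq R$ (with $SS\subseteq S$, $1\in S$, $0\notin S$) is a left denominator set of $R$ if $Sr\cap Rs\neq\emptyset$ for all $r\in R$, $s\in S$, and if $rs=0$ with $r\in R$, $s\in S$ implies $tr=0$ for some $t\in S$; we write $S\in\mathrm{Den}_l(R,0)$ if moreover $\{r\in R : sr=0\text{ for some } s\in S\}=0$, and $S^{-1}R=\{s^{-1}r\}$ for the left localization. Let $Q_l(R)=\mathcal C_R^{-1}R$ be the classical left quotient ring. **Theorem.** Let $R$ be a semiprime left Goldie ring and let $R'$ be a subring of $R$ that contains an essential left ideal of $R$. Then: 1. $\mathcal C_{R'}=\mathcal C_R\cap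 R'$. 2. For each $c\in\mathcal C_R$ there is $c'\in\mathcal C_R$ such that $c'c\in\mathcal C_{R'}$. 3. $\mathcal C_{R'}\in\mathrm{Den}_l(R',0)\cap\mathrm{Den}_l(R,0)$. 4. The rings $Q_l(R')$, $\mathcal C_{R'}^{-1}R$ and $Q_l(R)$ exist, and $Q_l(R')=\mathcal C_{R'}^{-1}R'=\mathcal C_{R'}^{-1}R=Q_l(R)$; that is, there are ring isomorphisms $\mathcal C_{R'}^{-1}R'\cong\mathcal C_{R'}^{-1}R$ and $\mathcal C_{R'}^{-1}R\cong\mathcal C_R^{-1}R$ compatible with the canonical maps from $R'$ and from $R$, respectively. 5. $R'$ is a semiprime left Goldie ring. 6. $\mathrm{udim}(R')=\mathrm{udim}(R)$. -/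

import Mathlib

/-- A ring is semiprime if `a R a = 0` implies `a = 0`
(equivalently, it has no nonzero nilpotent ideals). -/
def IsSemiprimeRing (R : Type*) [Ring R] : Prop :=
  ∀ a : R, (∀ r : R, a * r * a = 0) → a = 0

/-- The uniform (Goldie) dimension of a left module: the supremum in `ℕ∞` of all `n` such that
the module contains a direct sum of `n` nonzero submodules. -/
noncomputable def uniformDim (R M : Type*) [Ring R] [AddCommGroup M] [Module R M] : ℕ∞ :=
  ⨆ n ∈ {n : ℕ | ∃ N : Fin n → Submodule R M, (∀ i, N i ≠ ⊥) ∧ iSupIndep N}, (n : ℕ∞)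

/-- The left uniform dimension of a ring. -/
noncomputable def leftUdim (R : Type*) [Ring R] : ℕ∞ := uniformDim R R

/-- The left annihilator `{r | r x = 0 for all x ∈ X}` of a subset `X` of a ring. -/
def leftAnnihilator {R : Type*} [Ring R] (X : Set R) : Ideal R where
  carrier := {r | ∀ x ∈ X, r * x = 0}
  add_mem' := fun {a b} ha hb x hx => by rw [add_mul, ha x hx, hb x hx, add_zero]
  zero_mem' := fun x _ => zero_mul x
  smul_mem' := fun c r hr x hx => by rw [smul_eq_mul, mul_assoc, hr x hx, mul_zero]

/-- A left Goldie ring: finite left uniform dimension and the ascending chain condition on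
left annihilators of subsets. -/
structure IsLeftGoldie (R : Type*) [Ring R] : Prop where
  udim_lt_top : leftUdim R < ⊤
  acc : ∀ X : ℕ → Set R, Monotone (fun n => leftAnnihilator (X n)) →
    ∃ n, ∀ m, n ≤ m → leftAnnihilator (X m) = leftAnnihilator (X n)

/-- A left ideal is essential if it meets every nonzero left ideal nontrivially
(`Ideal R` is the type of left ideals). -/
def IsEssentialLeftIdeal {R : Type*} [Ring R] (I : Ideal R) : Prop :=
  ∀ J : Ideal R, J ≠ ⊥ → I ⊓ J ≠ ⊥

/-- A subring is large if it contains an essential left ideal of the ambient ring. -/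
def IsLargeSubring {R : Type*} [Ring R] (R' : Subring R) : Prop :=
  ∃ I : Ideal R, IsEssentialLeftIdeal I ∧ (I : Set R) ⊆ (R' : Set R)

/-- The set of regular elements of a subring `R'`, viewed as a multiplicative submonoid
of the ambient ring. -/
def regularIn {R : Type*} [Ring R] (R' : Subring R) : Submonoid R :=
  (nonZeroDivisors R').map R'.subtype

/-- Left denominator sets: multiplicative sets without zero that satisfy the left Ore condition
`S r ∩ R s ≠ ∅` and such that `r s = 0` implies `t r = 0` for some `t ∈ S`. -/
structure IsLeftDenominatorSet {R : Type*} [Ring R] (S : Submonoid R) : Prop where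
  zero_notMem : (0 : R) ∉ S
  ore : ∀ r : R, ∀ s ∈ S, ∃ s' ∈ S, ∃ r' : R, s' * r = r' * s
  reversible : ∀ r : R, ∀ s ∈ S, r * s = 0 → ∃ t ∈ S, t * r = 0

/-- `ass_l(S)`, the set of elements of the ring annihilated on the left by an element of `S`. -/
def leftAss {R : Type*} [Ring R] (S : Submonoid R) : Set R :=
  {r | ∃ s ∈ S, s * r = 0}

/-- A left denominator set is a left Ore set in the sense of Mathlib. -/
theorem IsLeftDenominatorSet.nonempty_oreSet {R : Type*} [Ring R] {S : Submonoid R}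
    (h : IsLeftDenominatorSet S) : Nonempty (OreLocalization.OreSet S) := by
  rw [OreLocalization.nonempty_oreSet_iff]
  refine ⟨fun r₁ r₂ s hs => ?_, fun r s => ?_⟩
  · obtain ⟨t, ht, h0⟩ := h.reversible (r₁ - r₂) s s.2 (by rw [sub_mul, hs, sub_self])
    exact ⟨⟨t, ht⟩, by rw [mul_sub] at h0; exact sub_eq_zero.mp h0⟩
  · obtain ⟨s', hs', r', he⟩ := h.ore r s s.2
    exact ⟨r', ⟨s', hs'⟩, he⟩

/-- A choice of Ore numerators and denominators. -/
@[reducible]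
noncomputable def IsLeftDenominatorSet.oreSet {R : Type*} [Ring R] {S : Submonoid R}
    (h : IsLeftDenominatorSet S) : OreLocalization.OreSet S :=
  Classical.choice h.nonempty_oreSet

/-- The left localization `S⁻¹R = {s⁻¹r}` of a ring at a left denominator set. -/
abbrev LeftLocalization {R : Type*} [Ring R] (S : Submonoid R)
    (h : IsLeftDenominatorSet S) : Type _ :=
  @OreLocalization R _ S h.oreSet R _

/-- The ring structure of `S⁻¹R`. -/
noncomputable instance LeftLocalization.instRing {R : Type*} [Ring R] (S : Submonoid R)
    (h : IsLeftDenominatorSet S) : Ring (LeftLocalization S h) :=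
  letI := h.oreSet
  inferInstanceAs (Ring (OreLocalization S R))

/-- The canonical homomorphism `R → S⁻¹R`, `r ↦ r / 1`. -/
noncomputable def LeftLocalization.of {R : Type*} [Ring R] (S : Submonoid R)
    (h : IsLeftDenominatorSet S) : R →+* LeftLocalization S h :=
  letI := h.oreSet
  OreLocalization.numeratorRingHom

/-- The classical left quotient ring `Q_l(R)`, the left localization of `R` at the set of its
regular elements; it exists when that set is a left denominator set. -/
abbrev LeftQuotientRing (R : Type*) [Ring R]
    (h : IsLeftDenominatorSet (nonZeroDivisors R)) : Type _ :=
  LeftLocalization (nonZeroDivisors R) h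

/-! Goldie's theory for `R` does most of the work: essential left ideals contain regular elements,
regular elements generate essential left ideals, and a zero left annihilator already forces
regularity. Let I be an essential left ideal of `R` inside `R'`. For essential E and any r, the left
ideal {x | xr ∈ E} ∩ I is essential, so it contains a regular c; this c lies in `R'` and cr ∈ E.
This is `exists_regularIn_mul_mem`. Taking E = Rs gives the Ore conditions in `R`, and E = I clears
numerators into `R'`, so all three localizations agree. Semiprimeness and uniform dimension pass to
`R'` through a regular c ∈ I, because Rc ⊆ `R'`. -/

/-! ### Essential left ideals. -/

section Essential

variable {R : Type*} [Ring R]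

theorem mem_leftAnnihilator_singleton {a r : R} :
    r ∈ leftAnnihilator ({a} : Set R) ↔ r * a = 0 :=
  ⟨fun h => h a rfl, fun h x hx => by rw [Set.mem_singleton_iff.mp hx, h]⟩

theorem isEssentialLeftIdeal_iff {I : Ideal R} :
    IsEssentialLeftIdeal I ↔ ∀ x : R, x ≠ 0 → ∃ y, y * x ≠ 0 ∧ y * x ∈ I := by
  constructor
  · intro h x hx
    have h1 := h (Ideal.span {x}) (by simpa using hx)
    obtain ⟨z, hz, hz0⟩ := Submodule.exists_mem_ne_zero_of_ne_bot h1
    obtain ⟨y, rfl⟩ := Ideal.mem_span_singleton'.mp hz.2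
    exact ⟨y, hz0, hz.1⟩
  · intro h J hJ hbot
    obtain ⟨x, hx, hx0⟩ := Submodule.exists_mem_ne_zero_of_ne_bot hJ
    obtain ⟨y, hy0, hy⟩ := h x hx0
    have : y * x ∈ I ⊓ J := ⟨hy, J.mul_mem_left y hx⟩
    rw [hbot] at this
    exact hy0 this

theorem IsEssentialLeftIdeal.mono {I J : Ideal R} (h : IsEssentialLeftIdeal I) (hIJ : I ≤ J) :
    IsEssentialLeftIdeal J := by
  rw [isEssentialLeftIdeal_iff] at h ⊢
  exact fun x hx => (h x hx).imp fun y hy => ⟨hy.1, hIJ hy.2⟩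

theorem IsEssentialLeftIdeal.inf {I J : Ideal R} (hI : IsEssentialLeftIdeal I)
    (hJ : IsEssentialLeftIdeal J) : IsEssentialLeftIdeal (I ⊓ J) := by
  intro K hK
  rw [inf_assoc]
  exact hI _ (hJ K hK)

/-- The left ideal `{x | x r ∈ I}`. -/
def leftColon (I : Ideal R) (r : R) : Ideal R :=
  Submodule.comap (LinearMap.toSpanSingleton R R r) I

theorem mem_leftColon {I : Ideal R} {r x : R} : x ∈ leftColon I r ↔ x * r ∈ I := Iff.rfl

theorem IsEssentialLeftIdeal.leftColon {I : Ideal R} (h : IsEssentialLeftIdeal I) (r : R) :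
    IsEssentialLeftIdeal (leftColon I r) := by
  rw [isEssentialLeftIdeal_iff] at h ⊢
  intro x hx
  by_cases hxr : x * r = 0
  · exact ⟨1, by simpa using hx, by rw [mem_leftColon, one_mul, hxr]; exact I.zero_mem⟩
  · obtain ⟨y, hy0, hy⟩ := h _ hxr
    rw [← mul_assoc] at hy0 hy
    exact ⟨y, fun h0 => hy0 (by rw [h0, zero_mul]), hy⟩

end Essential

/-! ### Infinite direct sums and finite uniform dimension. -/

section UniformDimension

variable {R : Type*} [Ring R]

/-- A family of submodules lying on a descending chain, each of them meeting the next member of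
the chain trivially, is independent. -/
theorem iSupIndep_of_antitone {M : Type*} [AddCommGroup M] [Module R M]
    {L N : ℕ → Submodule R M} (hL : Antitone L)
    (hNL : ∀ k, N k ≤ L k) (hN : ∀ k, Disjoint (N k) (L (k + 1))) : iSupIndep N := by
  classical
  rw [iSupIndep_iff_finsetSum_eq_zero_imp_eq_zero]
  intro s v hv hsum i
  induction i using Nat.strong_induction_on with
  | _ i ih =>
    intro hi
    rw [← Finset.add_sum_erase s v hi] at hsum
    have hrest : ∑ j ∈ s.erase i, v j ∈ L (i + 1) := by
      refine Submodule.sum_mem _ fun j hj => ?_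
      obtain ⟨hji, hjs⟩ := Finset.mem_erase.mp hj
      rcases lt_or_gt_of_ne hji with h | h
      · rw [ih j h hjs]
        exact Submodule.zero_mem _
      · exact hL h (hNL j (hv j hjs))
    refine Submodule.disjoint_def.mp (hN i) _ (hv i hi) ?_
    rw [eq_neg_of_add_eq_zero_left hsum]
    exact Submodule.neg_mem _ hrest

theorem uniformDim_eq_top_of_iSupIndep {M : Type*} [AddCommGroup M] [Module R M]
    {N : ℕ → Submodule R M} (h0 : ∀ k, N k ≠ ⊥) (hN : iSupIndep N) : uniformDim R M = ⊤ := by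
  rw [uniformDim, ENat.eq_top_iff_forall_ge]
  intro m
  exact le_iSup₂_of_le (f := fun n (_ : n ∈ {n : ℕ | ∃ N : Fin n → Submodule R M,
    (∀ i, N i ≠ ⊥) ∧ iSupIndep N}) => (n : ℕ∞)) m
    ⟨fun i => N i, fun i => h0 i, hN.comp Fin.val_injective⟩ le_rfl

/-- In a ring of finite left uniform dimension, an element with zero left annihilator generates
an essential left ideal. -/
theorem isEssentialLeftIdeal_span_of_leftUdim (hR : leftUdim R < ⊤) {c : R}
    (hc : ∀ x, x * c = 0 → x = 0) : IsEssentialLeftIdeal (Ideal.span {c}) := by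
  intro J hJ hbot
  have hpow : ∀ (k : ℕ) (x : R), x * c ^ k = 0 → x = 0 := by
    intro k
    induction k with
    | zero => intro x hx; simpa using hx
    | succ k ih => intro x hx; exact ih x (hc _ (by rw [mul_assoc, ← pow_succ, hx]))
  -- If J ∩ Rc = 0, the left ideals Jc^k form an infinite direct sum: cancelling c^k shows that Jc^k
  -- misses Rc^(k+1).
  refine hR.ne (uniformDim_eq_top_of_iSupIndep
    (N := fun k => Submodule.map (LinearMap.toSpanSingleton R R (c ^ k)) J) ?_
    (iSupIndep_of_antitone (L := fun k => Ideal.span {c ^ k}) ?_ ?_ ?_))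
  · intro k h
    obtain ⟨x, hx, hx0⟩ := Submodule.exists_mem_ne_zero_of_ne_bot hJ
    have : x * c ^ k ∈ Submodule.map (LinearMap.toSpanSingleton R R (c ^ k)) J :=
      Submodule.mem_map.mpr ⟨x, hx, rfl⟩
    rw [h] at this
    exact hx0 (hpow k x this)
  · refine antitone_nat_of_succ_le fun k => ?_
    rw [Ideal.span_singleton_le_iff_mem]
    exact Ideal.mem_span_singleton'.mpr ⟨c, (pow_succ' c k).symm⟩
  · intro k z hz
    obtain ⟨x, -, rfl⟩ := Submodule.mem_map.mp hz
    exact Ideal.mem_span_singleton'.mpr ⟨x, rfl⟩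
  · intro k
    rw [Submodule.disjoint_def]
    intro z hz hmem
    obtain ⟨x, hx, rfl⟩ := Submodule.mem_map.mp hz
    obtain ⟨r, hr⟩ := Ideal.mem_span_singleton'.mp hmem
    have hx' : x * c ^ k = r * c ^ (k + 1) := hr.symm
    have h1 : x = r * c := by
      refine sub_eq_zero.mp (hpow k _ ?_)
      rw [sub_mul, hx', pow_succ', mul_assoc, sub_self]
    have h2 : x ∈ Ideal.span {c} ⊓ J := ⟨Ideal.mem_span_singleton'.mpr ⟨r, h1.symm⟩, hx⟩
    rw [hbot] at h2
    have h3 : x = 0 := h2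
    simp [h3]

end UniformDimension

/-! ### Goldie's theorem on regular elements. -/

section Goldie

variable {R : Type*} [Ring R]

/-- Without a maximal member, iterated choice would build a strictly ascending chain of
annihilators. -/
theorem IsLeftGoldie.exists_maximal_leftAnnihilator (hR : IsLeftGoldie R) {A : Set R}
    (hA : A.Nonempty) : ∃ a ∈ A, ∀ b ∈ A,
      leftAnnihilator {a} ≤ leftAnnihilator {b} → leftAnnihilator {b} ≤ leftAnnihilator {a} := by
  by_contra! hcon
  choose f hfA hle hnle using hcon
  obtain ⟨a₀, ha₀⟩ := hA
  let g : A → A := fun a => ⟨f a a.2, hfA a a.2⟩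
  let u : ℕ → A := fun n => g^[n] ⟨a₀, ha₀⟩
  have hu : ∀ n, u (n + 1) = g (u n) := fun n => Function.iterate_succ_apply' g n _
  obtain ⟨n, hn⟩ := hR.acc (fun n => {(u n : R)}) (monotone_nat_of_le_succ fun n => by
    simp only [hu]
    exact hle _ _)
  have h1 := hn (n + 1) n.le_succ
  simp only [hu] at h1
  exact hnle (u n) (u n).2 h1.le

/-- A semiprime left Goldie ring is left nonsingular. -/
theorem IsLeftGoldie.eq_zero_of_isEssentialLeftIdeal (hR : IsLeftGoldie R)
    (hs : IsSemiprimeRing R) {x : R} (hx : IsEssentialLeftIdeal (leftAnnihilator {x})) :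
    x = 0 := by
  by_contra hx0
  obtain ⟨a, ⟨ha, ha0⟩, hmax⟩ := hR.exists_maximal_leftAnnihilator
    (A := {a : R | IsEssentialLeftIdeal (leftAnnihilator {a}) ∧ a ≠ 0}) ⟨x, hx, hx0⟩
  refine ha0 (hs a fun r => ?_)
  by_contra hara
  have hle : leftAnnihilator {a} ≤ leftAnnihilator {a * r * a} := fun y hy => by
    rw [mem_leftAnnihilator_singleton] at hy ⊢
    rw [← mul_assoc, ← mul_assoc, hy, zero_mul, zero_mul]
  have hge := hmax _ ⟨ha.mono hle, hara⟩ hle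
  -- Essentiality gives y with ya ≠ 0 and yara = 0, against ann(ara) = ann(a).
  obtain ⟨y, hya, hy⟩ := isEssentialLeftIdeal_iff.mp (ha.leftColon r) a ha0
  rw [mem_leftColon, mem_leftAnnihilator_singleton] at hy
  refine hya (mem_leftAnnihilator_singleton.mp (hge ?_))
  rw [mem_leftAnnihilator_singleton, ← mul_assoc, ← mul_assoc, hy]

/-- A nonzero left ideal of a semiprime left Goldie ring is not nil. -/
theorem IsLeftGoldie.exists_pow_ne_zero (hR : IsLeftGoldie R) (hs : IsSemiprimeRing R)
    {b : R} (hb : b ≠ 0) : ∃ r, ∀ n, (r * b) ^ n ≠ 0 := by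
  by_contra! hnil
  obtain ⟨a, ⟨⟨t, rfl⟩, ha0⟩, hmax⟩ := hR.exists_maximal_leftAnnihilator
    (A := {a : R | (∃ t, a = b * t) ∧ a ≠ 0}) ⟨b, ⟨1, (mul_one b).symm⟩, hb⟩
  refine ha0 (hs _ fun r => ?_)
  -- Nilpotency passes from Rb to bR because (bu)^n b = b(ub)^n.
  have hn : ∃ n, (b * (t * r)) ^ n * (b * t) = 0 := by
    obtain ⟨n, hn⟩ := hnil (t * r)
    refine ⟨n, ?_⟩
    have hcomm : ∀ n : ℕ, (b * (t * r)) ^ n * b = b * (t * r * b) ^ n := by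
      intro n
      induction n with
      | zero => simp
      | succ n ih => rw [pow_succ', mul_assoc, ih, pow_succ']; simp only [mul_assoc]
    rw [← mul_assoc, hcomm, hn, mul_zero, zero_mul]
  classical
  have hspec := Nat.find_spec hn
  rcases hk : Nat.find hn with _ | k
  · rw [hk] at hspec
    exact absurd (by simpa using hspec) ha0
  · rw [hk] at hspec
    have hne : (b * (t * r)) ^ k * (b * t) ≠ 0 := Nat.find_min hn (by omega)
    rcases k with _ | k
    · simpa [mul_assoc] using hspec
    -- The last nonzero (btr)^(k+1)bt lies in bR, so by maximality it has the same left annihilator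
    -- as bt. Since btr kills it, btr kills bt.
    have hle : leftAnnihilator {b * t} ≤
        leftAnnihilator {(b * (t * r)) ^ (k + 1) * (b * t)} := fun y hy => by
      rw [mem_leftAnnihilator_singleton] at hy ⊢
      rw [pow_succ', show y * (b * (t * r) * (b * (t * r)) ^ k * (b * t)) =
        (y * (b * t)) * (r * (b * (t * r)) ^ k * (b * t)) by simp only [mul_assoc], hy, zero_mul]
    have hge := hmax _ ⟨⟨t * r * ((b * (t * r)) ^ k * (b * t)), by
      rw [pow_succ']; simp only [mul_assoc]⟩, hne⟩ hle
    have hmem : b * (t * r) ∈ leftAnnihilator {(b * (t * r)) ^ (k + 1) * (b * t)} := by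
      rw [mem_leftAnnihilator_singleton, ← mul_assoc, ← pow_succ', hspec]
    have := mem_leftAnnihilator_singleton.mp (hge hmem)
    simpa [mul_assoc] using this

/-- The left annihilators of the powers of a non-nilpotent x ∈ J stabilize, so a high power y
satisfies Ry ∩ ann(y) = 0. -/
theorem IsLeftGoldie.exists_mul_self (hR : IsLeftGoldie R) (hs : IsSemiprimeRing R)
    {J : Ideal R} (hJ : J ≠ ⊥) : ∃ y ∈ J, y ≠ 0 ∧ ∀ r, r * y * y = 0 → r * y = 0 := by
  obtain ⟨b, hb, hb0⟩ := Submodule.exists_mem_ne_zero_of_ne_bot hJ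
  obtain ⟨r, hr⟩ := hR.exists_pow_ne_zero hs hb0
  set x := r * b with hx
  have hmono : Monotone fun n : ℕ => leftAnnihilator {x ^ n} :=
    monotone_nat_of_le_succ fun n y hy => by
      rw [mem_leftAnnihilator_singleton] at hy ⊢
      rw [pow_succ, ← mul_assoc, hy, zero_mul]
  obtain ⟨n, hn⟩ := hR.acc (fun n => {x ^ n}) hmono
  -- The exponent n + 1 keeps the power in J even when n = 0.
  refine ⟨x ^ (n + 1), ?_, hr _, fun z hz => ?_⟩
  · rw [pow_succ]
    exact J.mul_mem_left _ (J.mul_mem_left _ hb)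
  · have h1 : z ∈ leftAnnihilator {x ^ (n + 1 + (n + 1))} := by
      rw [mem_leftAnnihilator_singleton, pow_add, ← mul_assoc, hz]
    rw [hn _ (by omega), ← hn (n + 1) (by omega)] at h1
    exact mem_leftAnnihilator_singleton.mp h1

/-- An essential left ideal of a semiprime left Goldie ring contains an element with zero left
annihilator. -/
theorem IsLeftGoldie.exists_mem_mul_eq_zero (hR : IsLeftGoldie R) (hs : IsSemiprimeRing R)
    {E : Ideal R} (hE : IsEssentialLeftIdeal E) : ∃ a ∈ E, ∀ x, x * a = 0 → x = 0 := by
  by_contra! hcon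
  -- `P` consists of the s ∈ E with Rs ∩ ann(s) = 0. If ann(s) ≠ 0, some nonzero y ∈ E ∩ ann(s) has
  -- the same property; then s + y ∈ `P` and ann(s + y) = ann(s) ∩ ann(y). Iterating from 0 yields
  -- an infinite direct sum of left ideals Ry.
  let P : Set R := {s | s ∈ E ∧ ∀ r, r * s * s = 0 → r * s = 0}
  have hstep : ∀ s : P, ∃ y : R, y ≠ 0 ∧ y * s = 0 ∧ (∀ r, r * y * y = 0 → r * y = 0) ∧
      (s : R) + y ∈ P := by
    rintro ⟨s, hsE, hss⟩
    obtain ⟨x, hx, hx0⟩ := hcon s hsE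
    have hne : E ⊓ leftAnnihilator {s} ≠ ⊥ := hE _ fun h => hx0 <| by
      have := mem_leftAnnihilator_singleton.mpr hx
      rw [h] at this
      exact this
    obtain ⟨y, ⟨hyE, hys⟩, hy0, hyy⟩ := hR.exists_mul_self hs hne
    have hys : y * s = 0 := mem_leftAnnihilator_singleton.mp hys
    refine ⟨y, hy0, hys, hyy, E.add_mem hsE hyE, fun r hr => ?_⟩
    have h1 : r * s * s + r * s * y + r * y * y = 0 := by
      have : r * (s + y) * (s + y) =
          r * s * s + r * s * y + r * (y * s) + r * y * y := by noncomm_ring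
      rwa [this, hys, mul_zero, add_zero] at hr
    have h2 : r * s = 0 := by
      have h3 : r * s * s * s = 0 := by
        have h4 : (r * s * s + r * s * y + r * y * y) * s =
            r * s * s * s + r * s * (y * s) + r * y * (y * s) := by noncomm_ring
        rw [h1, hys, mul_zero, mul_zero, zero_mul, add_zero, add_zero] at h4
        exact h4.symm
      exact hss r (hss (r * s) h3)
    rw [h2, zero_mul, zero_mul, zero_add, zero_add] at h1
    rw [mul_add, h2, hyy r h1, add_zero]
  choose f hf0 hfs hff hfP using hstep
  let g : P → P := fun s => ⟨s + f s, hfP s⟩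
  let u : ℕ → P := fun n => g^[n] ⟨0, E.zero_mem, by simp⟩
  have hu : ∀ n, u (n + 1) = g (u n) := fun n => Function.iterate_succ_apply' g n _
  have hann : ∀ (s : P) (r : R), r * (s + f s) = 0 → r * s = 0 ∧ r * f s = 0 := by
    intro s r hr
    have h1 : r * s = 0 := by
      refine s.2.2 r ?_
      have : r * (s + f s) * s = r * s * s + r * (f s * s) := by noncomm_ring
      rw [hr, hfs, mul_zero, zero_mul, add_zero] at this
      exact this.symm
    exact ⟨h1, by rwa [mul_add, h1, zero_add] at hr⟩
  refine hR.udim_lt_top.ne (uniformDim_eq_top_of_iSupIndep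
    (N := fun k => Ideal.span {f (u k)}) (fun k => by simpa using hf0 (u k))
    (iSupIndep_of_antitone (L := fun k => leftAnnihilator {(u k : R)}) ?_ ?_ ?_))
  · refine antitone_nat_of_succ_le fun k r hr => ?_
    rw [hu, mem_leftAnnihilator_singleton] at hr
    exact mem_leftAnnihilator_singleton.mpr (hann _ _ hr).1
  · intro k
    rw [Ideal.span_singleton_le_iff_mem, mem_leftAnnihilator_singleton]
    exact hfs _
  · intro k
    rw [Submodule.disjoint_def]
    intro z hz hz'
    obtain ⟨r, rfl⟩ := Ideal.mem_span_singleton'.mp hz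
    rw [hu, mem_leftAnnihilator_singleton] at hz'
    exact hff _ _ (hann _ _ hz').2

/-- In a semiprime left Goldie ring, an element with zero left annihilator is regular. -/
theorem IsLeftGoldie.mem_nonZeroDivisors (hR : IsLeftGoldie R) (hs : IsSemiprimeRing R)
    {c : R} (hc : ∀ x, x * c = 0 → x = 0) : c ∈ nonZeroDivisors R := by
  refine mem_nonZeroDivisors_iff.mpr ⟨fun x hx => ?_, hc⟩
  refine hR.eq_zero_of_isEssentialLeftIdeal hs
    ((isEssentialLeftIdeal_span_of_leftUdim hR.udim_lt_top hc).mono ?_)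
  rwa [Ideal.span_singleton_le_iff_mem, mem_leftAnnihilator_singleton]

/-- An essential left ideal of a semiprime left Goldie ring contains a regular element. -/
theorem IsLeftGoldie.exists_mem_nonZeroDivisors (hR : IsLeftGoldie R) (hs : IsSemiprimeRing R)
    {E : Ideal R} (hE : IsEssentialLeftIdeal E) : ∃ c ∈ E, c ∈ nonZeroDivisors R := by
  obtain ⟨c, hcE, hc⟩ := hR.exists_mem_mul_eq_zero hs hE
  exact ⟨c, hcE, hR.mem_nonZeroDivisors hs hc⟩

theorem IsLeftGoldie.isEssentialLeftIdeal_span (hR : IsLeftGoldie R) {c : R}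
    (hc : c ∈ nonZeroDivisors R) : IsEssentialLeftIdeal (Ideal.span {c}) :=
  isEssentialLeftIdeal_span_of_leftUdim hR.udim_lt_top (mem_nonZeroDivisors_iff.mp hc).2

end Goldie

/-! ### Left localizations and their universal property. -/

section Localization

variable {R : Type*} [Ring R]

theorem isLeftDenominatorSet_of_le_nonZeroDivisors [Nontrivial R] {S : Submonoid R}
    (hS : S ≤ nonZeroDivisors R)
    (hore : ∀ r : R, ∀ s ∈ S, ∃ s' ∈ S, ∃ r' : R, s' * r = r' * s) : IsLeftDenominatorSet S where
  zero_notMem h0 := zero_notMem_nonZeroDivisors (hS h0)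
  ore := hore
  reversible r s hs h :=
    ⟨1, S.one_mem, by rw [one_mul]; exact (mem_nonZeroDivisors_iff.mp (hS hs)).2 r h⟩

theorem leftAss_eq_of_le_nonZeroDivisors {S : Submonoid R} (hS : S ≤ nonZeroDivisors R) :
    leftAss S = {0} := by
  ext r
  constructor
  · rintro ⟨s, hs, h⟩
    exact (mem_nonZeroDivisors_iff.mp (hS hs)).1 r h
  · rintro rfl
    exact ⟨1, S.one_mem, mul_zero 1⟩

namespace LeftLocalization

variable {S : Submonoid R} (h : IsLeftDenominatorSet S)

theorem isUnit_of {s : R} (hs : s ∈ S) : IsUnit (of S h s) :=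
  let := h.oreSet
  OreLocalization.numerator_isUnit (⟨s, hs⟩ : S)

theorem exists_of_mul_eq (q : LeftLocalization S h) : ∃ s ∈ S, ∃ r, of S h s * q = of S h r := by
  let := h.oreSet
  induction q using OreLocalization.ind with
  | _ r s =>
    exact ⟨s, s.2, r, OreLocalization.mul_cancel⟩

theorem exists_mul_eq_zero_of_of_eq_zero {r : R} (hr : of S h r = 0) : ∃ s ∈ S, s * r = 0 := by
  let := h.oreSet
  have h1 : (r /ₒ (1 : S) : OreLocalization S R) = 0 /ₒ 1 :=
    hr.trans OreLocalization.zero_def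
  obtain ⟨u, v, h2, h3⟩ := OreLocalization.oreDiv_eq_iff.mp h1
  have h3 : (u : R) = v := by simpa using h3
  refine ⟨u, u.2, ?_⟩
  rw [h3]
  simpa using h2.symm

/-- The universal property of the left localization characterizes it up to isomorphism. -/
theorem exists_ringEquiv {Q : Type*} [Ring Q] (φ : R →+* Q)
    (hunit : ∀ s ∈ S, IsUnit (φ s)) (hker : ∀ r, φ r = 0 → ∃ s ∈ S, s * r = 0)
    (hsurj : ∀ q : Q, ∃ s ∈ S, ∃ r, φ s * q = φ r) :
    ∃ e : LeftLocalization S h ≃+* Q, ∀ r, e (of S h r) = φ r := by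
  let := h.oreSet
  let φS : S →* Qˣ := IsUnit.liftRight ((φ : R →* Q).comp S.subtype) fun s => hunit s s.2
  have hφS : ∀ s : S, φ s = φS s := fun s =>
    (IsUnit.coe_liftRight ((φ : R →* Q).comp S.subtype) (fun s => hunit s s.2) s).symm
  let e : LeftLocalization S h →+* Q := OreLocalization.universalHom φ φS hφS
  have he : ∀ r, e (of S h r) = φ r := fun r =>
    OreLocalization.universalHom_commutes φ φS hφS
  refine ⟨RingEquiv.ofBijective e ⟨?_, ?_⟩, he⟩
  · rw [injective_iff_map_eq_zero]
    intro q hq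
    obtain ⟨s, hs, r, hr⟩ := exists_of_mul_eq h q
    have h1 : φ r = 0 := by rw [← he, ← hr, map_mul, hq, mul_zero]
    obtain ⟨t, ht, htr⟩ := hker r h1
    have h2 : of S h r = 0 := by
      rw [← (isUnit_of h ht).mul_right_eq_zero, ← map_mul, htr, map_zero]
    rwa [h2, (isUnit_of h hs).mul_right_eq_zero] at hr
  · intro q
    obtain ⟨s, hs, r, hr⟩ := hsurj q
    obtain ⟨v, hv⟩ := isUnit_of h hs
    refine ⟨↑v⁻¹ * of S h r, (hunit s hs).mul_left_cancel ?_⟩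
    rw [hr, ← he s, ← map_mul, ← mul_assoc, ← hv, Units.mul_inv, one_mul, he]

end LeftLocalization

end Localization

/-! ### Transfer between a ring and a large subring. -/

section LargeSubring

variable {R : Type*} [Ring R] {R' : Subring R}

theorem mem_regularIn {x : R} :
    x ∈ regularIn R' ↔ ∃ hx : x ∈ R', (⟨x, hx⟩ : R') ∈ nonZeroDivisors R' := by
  constructor
  · rintro ⟨y, hy, rfl⟩
    exact ⟨y.2, hy⟩
  · rintro ⟨hx, h⟩
    exact ⟨_, h, rfl⟩

/-- A nonzero x with xa = 0 has a nonzero multiple yx in I ⊆ `R'`, still killing a; so a has zero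
left annihilator in `R`, which suffices for regularity. -/
theorem regularIn_eq (hs : IsSemiprimeRing R) (hR : IsLeftGoldie R) (h : IsLargeSubring R') :
    (regularIn R' : Set R) = (nonZeroDivisors R : Set R) ∩ (R' : Set R) := by
  obtain ⟨I, hI, hIR⟩ := h
  ext a
  rw [SetLike.mem_coe, mem_regularIn]
  constructor
  · rintro ⟨ha, hreg⟩
    refine ⟨hR.mem_nonZeroDivisors hs fun x hx => ?_, ha⟩
    by_contra hx0
    obtain ⟨y, hy0, hy⟩ := isEssentialLeftIdeal_iff.mp hI x hx0
    refine hy0 (congrArg Subtype.val ((mem_nonZeroDivisors_iff.mp hreg).2 ⟨y * x, hIR hy⟩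
      (Subtype.ext ?_)))
    change y * x * a = 0
    rw [mul_assoc, hx, mul_zero]
  · rintro ⟨hreg, ha⟩
    refine ⟨ha, mem_nonZeroDivisors_iff.mpr ⟨fun x hx => ?_, fun x hx => ?_⟩⟩
    · exact Subtype.ext ((mem_nonZeroDivisors_iff.mp hreg).1 x (congrArg Subtype.val hx))
    · exact Subtype.ext ((mem_nonZeroDivisors_iff.mp hreg).2 x (congrArg Subtype.val hx))

theorem isSemiprimeRing_of_large (hs : IsSemiprimeRing R) (hR : IsLeftGoldie R)
    (h : IsLargeSubring R') : IsSemiprimeRing R' := by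
  obtain ⟨I, hI, hIR⟩ := h
  obtain ⟨c, hcI, hc⟩ := hR.exists_mem_nonZeroDivisors hs hI
  rintro ⟨a, ha⟩ hz
  have hz' : ∀ r ∈ R', a * r * a = 0 := fun r hr => congrArg Subtype.val (hz ⟨r, hr⟩)
  refine Subtype.ext ((mem_nonZeroDivisors_iff.mp hc).1 a (hs _ fun r => ?_))
  rw [show c * a * r * (c * a) = c * (a * (r * c) * a) by simp only [mul_assoc],
    hz' _ (hIR (I.mul_mem_left r hcI)), mul_zero]

/-- With c ∈ I regular, nonzero x_i ∈ N_i give left ideals Rcx_i of `R`, contained in N_i since Rc ⊆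
`R'`. Conversely N_i ∩ `R'` is nonzero because it contains N_i ∩ I. -/
theorem leftUdim_eq_of_large (hs : IsSemiprimeRing R) (hR : IsLeftGoldie R)
    (h : IsLargeSubring R') : leftUdim R' = leftUdim R := by
  classical
  obtain ⟨I, hI, hIR⟩ := h
  obtain ⟨c, hcI, hc⟩ := hR.exists_mem_nonZeroDivisors hs hI
  suffices {n : ℕ | ∃ N : Fin n → Ideal R', (∀ i, N i ≠ ⊥) ∧ iSupIndep N} =
      {n : ℕ | ∃ N : Fin n → Ideal R, (∀ i, N i ≠ ⊥) ∧ iSupIndep N} by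
    change (⨆ n ∈ {n : ℕ | ∃ N : Fin n → Ideal R', (∀ i, N i ≠ ⊥) ∧ iSupIndep N}, (n : ℕ∞)) =
      ⨆ n ∈ {n : ℕ | ∃ N : Fin n → Ideal R, (∀ i, N i ≠ ⊥) ∧ iSupIndep N}, (n : ℕ∞)
    rw [this]
  ext n
  constructor
  · rintro ⟨N, hN0, hN⟩
    choose x hx hx0 using fun i => Submodule.exists_mem_ne_zero_of_ne_bot (hN0 i)
    refine ⟨fun i => Ideal.span {c * (x i : R)}, fun i => ?_, ?_⟩
    · rw [Ne, Ideal.span_singleton_eq_bot]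
      exact fun h0 => hx0 i (Subtype.ext ((mem_nonZeroDivisors_iff.mp hc).1 _ h0))
    · rw [iSupIndep_iff_finsetSum_eq_zero_imp_eq_zero] at hN ⊢
      intro s v hv hsum i hi
      have hmem : ∀ j ∈ s, ∃ w ∈ N j, (w : R) = v j := fun j hj => by
        obtain ⟨r, hr⟩ := Ideal.mem_span_singleton'.mp (hv j hj)
        exact ⟨⟨r * c, hIR (I.mul_mem_left r hcI)⟩ * x j, (N j).mul_mem_left _ (hx j), by
          rw [← hr, ← mul_assoc]; rfl⟩
      choose! w hw hwv using hmem
      have hw0 : ∑ j ∈ s, w j = 0 := by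
        refine Subtype.ext ?_
        rw [AddSubmonoidClass.coe_finsetSum, Finset.sum_congr rfl hwv, hsum]
        rfl
      rw [← hwv i hi, hN s w hw hw0 i hi]
      rfl
  · rintro ⟨N, hN0, hN⟩
    refine ⟨fun i => Ideal.comap R'.subtype (N i), fun i h0 => ?_, ?_⟩
    · obtain ⟨x, hx, hx0⟩ := Submodule.exists_mem_ne_zero_of_ne_bot (hI _ (hN0 i))
      have hxR : x ∈ R' := hIR hx.1
      have : (⟨x, hxR⟩ : R') ∈ (⊥ : Ideal R') := h0.le hx.2
      exact hx0 (congrArg Subtype.val this)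
    · rw [iSupIndep_iff_finsetSum_eq_zero_imp_eq_zero] at hN ⊢
      intro s v hv hsum i hi
      refine Subtype.ext (hN s (fun j => (v j : R)) hv ?_ i hi)
      rw [← AddSubmonoidClass.coe_finsetSum, hsum]
      rfl

/-- The ascending chain condition on left annihilators passes to subrings. -/
theorem acc_leftAnnihilator_of_subring (hR : IsLeftGoldie R) (R' : Subring R) (X : ℕ → Set R')
    (hX : Monotone fun n => leftAnnihilator (X n)) :
    ∃ n, ∀ m, n ≤ m → leftAnnihilator (X m) = leftAnnihilator (X n) := by
  -- The sets `X n` need not be nested. Their double annihilators in `R'` are, and have the same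
  -- left annihilators in `R'`.
  let Y : ℕ → Set R := fun n => {y | ∃ hy : y ∈ R', ∀ r ∈ leftAnnihilator (X n), r * ⟨y, hy⟩ = 0}
  have hY : ∀ n (r : R'), (r : R) ∈ leftAnnihilator (Y n) ↔ r ∈ leftAnnihilator (X n) := by
    refine fun n r => ⟨fun hr x hx => ?_, fun hr y ⟨hy, h⟩ => congrArg Subtype.val (h r hr)⟩
    exact Subtype.ext (hr x ⟨x.2, fun t ht => ht x hx⟩)
  obtain ⟨n, hn⟩ := hR.acc Y fun i j hij r hr y ⟨hy, h⟩ => hr y ⟨hy, fun t ht => h t (hX hij ht)⟩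
  refine ⟨n, fun m hm => ?_⟩
  ext r
  rw [← hY, ← hY, hn m hm]

theorem isLeftGoldie_of_large (hs : IsSemiprimeRing R) (hR : IsLeftGoldie R)
    (h : IsLargeSubring R') : IsLeftGoldie R' where
  udim_lt_top := by
    rw [leftUdim_eq_of_large hs hR h]
    exact hR.udim_lt_top
  acc := acc_leftAnnihilator_of_subring hR R'

/-- Every essential left ideal of the ambient ring contains a regular element of a large
subring. -/
theorem exists_mem_regularIn (hs : IsSemiprimeRing R) (hR : IsLeftGoldie R)
    (h : IsLargeSubring R') {E : Ideal R} (hE : IsEssentialLeftIdeal E) :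
    ∃ c ∈ E, c ∈ regularIn R' := by
  obtain ⟨I, hI, hIR⟩ := id h
  obtain ⟨c, hcE, hc⟩ := hR.exists_mem_nonZeroDivisors hs (hE.inf hI)
  refine ⟨c, hcE.1, ?_⟩
  rw [← SetLike.mem_coe, regularIn_eq hs hR h]
  exact ⟨hc, hIR hcE.2⟩

/-- Fractions of elements of a ring with denominators regular in a large subring have numerators
in any given essential left ideal. -/
theorem exists_regularIn_mul_mem (hs : IsSemiprimeRing R) (hR : IsLeftGoldie R)
    (h : IsLargeSubring R') {E : Ideal R} (hE : IsEssentialLeftIdeal E) (r : R) :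
    ∃ c ∈ regularIn R', c * r ∈ E := by
  obtain ⟨c, hcE, hc⟩ := exists_mem_regularIn hs hR h (hE.leftColon r)
  exact ⟨c, hc, hcE⟩

end LargeSubring

/-! ### Assembly of the theorem. -/

theorem mainTheorem6 {R : Type*} [Ring R] [Nontrivial R]
    (hsemiprime : IsSemiprimeRing R) (hgoldie : IsLeftGoldie R)
    (R' : Subring R) (hlarge : IsLargeSubring R') :
    -- the regular elements of `R'` are the regular elements of `R` lying in `R'`
    (regularIn R' : Set R) = (nonZeroDivisors R : Set R) ∩ (R' : Set R) ∧
    -- every regular element of `R` has a regular left multiple in the regular elements of `R'`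
    (∀ c ∈ nonZeroDivisors R, ∃ c' ∈ nonZeroDivisors R, c' * c ∈ regularIn R') ∧
    -- they form a left denominator set of `R'` and of `R`, with zero associated ideal
    ((IsLeftDenominatorSet (nonZeroDivisors R') ∧ leftAss (nonZeroDivisors R') = {0}) ∧
      (IsLeftDenominatorSet (regularIn R') ∧ leftAss (regularIn R') = {0})) ∧
    -- the three left quotient rings exist and coincide, by isomorphisms over `R'` and over `R`
    (∃ (h₁ : IsLeftDenominatorSet (nonZeroDivisors R'))
      (h₂ : IsLeftDenominatorSet (regularIn R'))
      (h₃ : IsLeftDenominatorSet (nonZeroDivisors R))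
      (f : LeftQuotientRing R' h₁ ≃+* LeftLocalization (regularIn R') h₂)
      (g : LeftLocalization (regularIn R') h₂ ≃+* LeftQuotientRing R h₃),
      (∀ r : R', f (LeftLocalization.of _ h₁ r) = LeftLocalization.of _ h₂ (r : R)) ∧
      (∀ r : R, g (LeftLocalization.of _ h₂ r) = LeftLocalization.of _ h₃ r)) ∧
    -- `R'` is a semiprime left Goldie ring
    (IsSemiprimeRing R' ∧ IsLeftGoldie R') ∧
    -- the left uniform dimensions agree
    leftUdim R' = leftUdim R := by
  obtain ⟨I, hI, hIR⟩ := id hlarge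
  have h1 := regularIn_eq hsemiprime hgoldie hlarge
  have hle : regularIn R' ≤ nonZeroDivisors R := fun x hx => (h1.subset hx).1
  have hesse : ∀ c ∈ nonZeroDivisors R, IsEssentialLeftIdeal (Ideal.span {c}) :=
    fun c hc => hgoldie.isEssentialLeftIdeal_span hc
  have hden₃ : IsLeftDenominatorSet (nonZeroDivisors R) :=
    isLeftDenominatorSet_of_le_nonZeroDivisors le_rfl fun r s hs => by
      obtain ⟨c, hc, hcr⟩ := exists_regularIn_mul_mem hsemiprime hgoldie hlarge (hesse s hs) r
      obtain ⟨y, hy⟩ := Ideal.mem_span_singleton'.mp hcr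
      exact ⟨c, hle hc, y, hy.symm⟩
  have hden₂ : IsLeftDenominatorSet (regularIn R') :=
    isLeftDenominatorSet_of_le_nonZeroDivisors hle fun r s hs => by
      obtain ⟨c, hc, hcr⟩ :=
        exists_regularIn_mul_mem hsemiprime hgoldie hlarge (hesse s (hle hs)) r
      obtain ⟨y, hy⟩ := Ideal.mem_span_singleton'.mp hcr
      exact ⟨c, hc, y, hy.symm⟩
  obtain ⟨d, hdI, hd⟩ := hgoldie.exists_mem_nonZeroDivisors hsemiprime hI
  have hden₁ : IsLeftDenominatorSet (nonZeroDivisors R') :=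
    isLeftDenominatorSet_of_le_nonZeroDivisors le_rfl fun r s hs => by
      have hs' : (s : R) ∈ regularIn R' := ⟨s, hs, rfl⟩
      -- Using Rds instead of Rs makes the new left factor yd, which lies in I ⊆ `R'`.
      obtain ⟨c, hc, hcr⟩ := exists_regularIn_mul_mem hsemiprime hgoldie hlarge
        (hesse (d * s) (mul_mem hd (hle hs'))) r
      obtain ⟨hcR, hc'⟩ := mem_regularIn.mp hc
      obtain ⟨y, hy⟩ := Ideal.mem_span_singleton'.mp hcr
      refine ⟨_, hc', ⟨y * d, hIR (I.mul_mem_left y hdI)⟩, Subtype.ext ?_⟩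
      change c * (r : R) = y * d * s
      rw [← hy, mul_assoc]
  have h2 : ∀ c ∈ nonZeroDivisors R, ∃ c' ∈ nonZeroDivisors R, c' * c ∈ regularIn R' := by
    intro c hc
    obtain ⟨c', hc', hmem⟩ := exists_regularIn_mul_mem hsemiprime hgoldie hlarge hI c
    refine ⟨c', hle hc', ?_⟩
    rw [← SetLike.mem_coe, h1]
    exact ⟨mul_mem (hle hc') hc, hIR hmem⟩
  refine ⟨h1, h2, ⟨⟨hden₁, leftAss_eq_of_le_nonZeroDivisors le_rfl⟩, hden₂,
    leftAss_eq_of_le_nonZeroDivisors hle⟩, ⟨hden₁, hden₂, hden₃, ?_⟩,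
    ⟨isSemiprimeRing_of_large hsemiprime hgoldie hlarge,
      isLeftGoldie_of_large hsemiprime hgoldie hlarge⟩,
    leftUdim_eq_of_large hsemiprime hgoldie hlarge⟩
  obtain ⟨f, hf⟩ := LeftLocalization.exists_ringEquiv hden₁
    ((LeftLocalization.of (regularIn R') hden₂).comp R'.subtype)
    (fun s hs => LeftLocalization.isUnit_of hden₂ ⟨s, hs, rfl⟩)
    (fun r hr => by
      obtain ⟨s, hs, hsr⟩ := LeftLocalization.exists_mul_eq_zero_of_of_eq_zero hden₂ hr
      obtain ⟨hsR, hs'⟩ := mem_regularIn.mp hs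
      exact ⟨_, hs', Subtype.ext hsr⟩)
    -- A fraction s⁻¹r equals (cs)⁻¹(cr), and c is chosen with cr ∈ I ⊆ `R'`.
    (fun q => by
      obtain ⟨s, hs, r, hr⟩ := LeftLocalization.exists_of_mul_eq hden₂ q
      obtain ⟨c, hc, hcr⟩ := exists_regularIn_mul_mem hsemiprime hgoldie hlarge hI r
      obtain ⟨hcsR, hcs⟩ := mem_regularIn.mp (mul_mem hc hs)
      refine ⟨_, hcs, ⟨c * r, hIR hcr⟩, ?_⟩
      change LeftLocalization.of _ hden₂ (c * s) * q = LeftLocalization.of _ hden₂ (c * r)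
      rw [map_mul, map_mul, mul_assoc, hr])
  obtain ⟨g, hg⟩ := LeftLocalization.exists_ringEquiv hden₂
    (LeftLocalization.of (nonZeroDivisors R) hden₃)
    (fun s hs => LeftLocalization.isUnit_of hden₃ (hle hs))
    (fun r hr => by
      obtain ⟨s, hs, hsr⟩ := LeftLocalization.exists_mul_eq_zero_of_of_eq_zero hden₃ hr
      exact ⟨1, one_mem _, by rw [(mem_nonZeroDivisors_iff.mp hs).1 r hsr, mul_zero]⟩)
    (fun q => by
      obtain ⟨s, hs, r, hr⟩ := LeftLocalization.exists_of_mul_eq hden₃ q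
      obtain ⟨c, hc, hcs⟩ := h2 s hs
      exact ⟨c * s, hcs, c * r, by rw [map_mul, map_mul, mul_assoc, hr]⟩)
  exact ⟨f, g, hf, hg⟩
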